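/- **Setting.** Fix an integer $N\ge 0$. A GARK-ROW method consists of stage numbers $s^{\{q\}}$, weights $\mathbf b^{\{q\}}\in\mathbb R^{s^{\{q\}}}$ and matrices $\boldsymbol\alpha^{\{q,m\}},\boldsymbol\gamma^{\{q,m\}}\in\mathbb R^{s^{\{q\}}\times s^{\{m\}}}$, $1\le q,m\le N$. One step of size $h$ from $y_n$ for a system $y'=\sum_{q=1}^N f^{\{q\}}(y)$, $y\in\mathbb R^d$, with matrices $L^{\{q\}}\in\mathbb R^{d\times d}$ (arbitrary approximations of the Jacobians of the $f^{\{q\}}$ at $y_n$), reads $$k_i^{\{q\}}=h\,f^{\{q\}}\Bigl(y_n+\sum_{m=1}^N\sum_{j=1}^{s^{\{m\}}}\alpha^{\{q,m\}}_{i,j}k_j^{\{m\}}\Bigr)+h\,L^{\{q\}}\sum_{m=1}^N\sum_{j=1}^{s^{\{m\}}}\gamma^{\{q,m\}}_{i,j}k_j^{\{m\}},\qquad y_{n+1}=y_n+\sum_{q=1}^N\sum_{i=1}^{s^{\{q\}}} b_i^{\{q\}}k_i^{\{q\}}.$$ The method has *order $p$* ($p\ge 0$ an integer) if for every $d$, all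 $C^\infty$ functions $f^{\{q\}}:\mathbb R^d\to\mathbb R^d$, all matrices $L^{\{q\}}$ (not depending on $h$) and every local exact solution $y$ with $y(t_n)=y_n$, the step from $y_n$ satisfies $y_{n+1}-y(t_n+h)=O(h^{p+1})$ as $h\to0^+$. Here the stages $k_i^{\{q\}}=k_i^{\{q\}}(h)$ are any solutions of the stage equations (for small $h>0$) that tend to $0$ as $h\to 0^+$; this is automatic if all $\boldsymbol\alpha^{\{q,m\}}$ are strictly lower triangular and all $\boldsymbol\gamma^{\{q,m\}}$ are lower triangular. **Trees.** $\mathbb{TW}_N$ is the set of rooted (unordered) trees, including the empty tree $\emptyset$, whose vertices are round or square, each colored in one of the colors $1,\dots,N$, such that every square vertex has exactly one child. $\mathbb T_N\subset\mathbb{TW}_N$ is the subset of trees all of whose vertices are round. $[t_1,\dots,t_L]_{\bigcirc q}$ ($L\ge0$) denotes the tree with a round root of color $q$ to which the nonempty trees $t_1,\dots,t_L$ are attached, and $[t_1]_{\square q}$ the tree with a square root of color $q$ to which the nonempty tree $t_1$ is attached. Let $\rho(t)$ be the number of vertices, and let $\gamma(\emptyset)=1$, $\gamma([t_1,\dots,t_L]_{\bigcirc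 q})=\rho(t)\,\gamma(t_1)\cdots\gamma(t_L)$ with $t=[t_1,\dots,t_L]_{\bigcirc q}$, and $\gamma([t_1]_{\square q})=\rho(t)\,\gamma(t_1)$ with $t=[t_1]_{\square q}$. Define $\boldsymbol\theta^{\{q\}}(t)\in\mathbb R^{s^{\{q\}}}$ and $\phi(t)\in\mathbb R$ by $$\boldsymbol\theta^{\{q\}}(t)=\begin{cases}0,&t=\emptyset,\\ \prod_{\ell=1}^{L}\Bigl(\sum_{m=1}^N\boldsymbol\alpha^{\{q,m\}}\boldsymbol\theta^{\{m\}}(t_\ell)\Bigr),&t=[t_1,\dots,t_L]_{\bigcirc q},\ L\ge 0,\\ \sum_{m=1}^N\boldsymbol\gamma^{\{q,m\}}\boldsymbol\theta^{\{m\}}(t_1),&t=[t_1]_{\square q},\\ 0,&\text{if the root of } t \text{ does not have color } q,\end{cases}$$ (element-by-element products of vectors; the empty product is the vector of ones), $\phi(\emptyset)=1$, and $\phi(t)=\sum_{q=1}^N\mathbf b^{\{q\}T}\boldsymbol\theta^{\{q\}}(t)$ for every nonempty $t\in\mathbb{TW}_N$. **Theorem (GARK-ROW order conditions).** The GARK-ROW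 method has order $p$ if and only if, for every $t\in\mathbb{TW}_N$ with $1\le\rho(t)\le p$, $$\phi(t)=\begin{cases}\dfrac1{\gamma(t)},&t\in\mathbb T_N,\\[1ex] 0,&t\in\mathbb{TW}_N\setminus\mathbb T_N.\end{cases}$$ -/

import Mathlib

open Filter Topology Asymptotics
open scoped ContDiff

/-- Plane (ordered) representatives of the nonempty rooted trees with round and square vertices
coloured by `Fin N`. A round vertex has any finite list of children (none for a leaf); a square
vertex has exactly one child, so there are no square leaves. -/
inductive PlaneTree (N : ℕ) : Type
  | round (m : Fin N) (children : List (PlaneTree N)) : PlaneTree N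
  | square (m : Fin N) (child : PlaneTree N) : PlaneTree N

namespace PlaneTree

variable {N : ℕ}

/-- Elementary changes of the plane representative: reordering the children of a round root, or
performing such a change inside one of the subtrees attached to the root. -/
inductive Step : PlaneTree N → PlaneTree N → Prop
  | perm (m : Fin N) {ts us : List (PlaneTree N)} (h : ts.Perm us) :
      Step (round m ts) (round m us)
  | roundChild (m : Fin N) (l r : List (PlaneTree N)) {t u : PlaneTree N} (h : Step t u) :
      Step (round m (l ++ t :: r)) (round m (l ++ u :: r))
  | squareChild (m : Fin N) {t u : PlaneTree N} (h : Step t u) :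
      Step (square m t) (square m u)

mutual
/-- The number of vertices. -/
def order : PlaneTree N → ℕ
  | round _ ts => 1 + orderSum ts
  | square _ t => 1 + order t
/-- The total number of vertices of a list of trees. -/
def orderSum : List (PlaneTree N) → ℕ
  | [] => 0
  | t :: ts => order t + orderSum ts
end

mutual
/-- The density: `γ(t) = ρ(t) γ(t₁) ⋯ γ(t_L)`, for a round as well as for a square root. -/
def density : PlaneTree N → ℕ
  | round _ ts => (1 + orderSum ts) * densityProd ts
  | square _ t => (1 + order t) * density t
/-- The product of the densities of a list of trees. -/
def densityProd : List (PlaneTree N) → ℕ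
  | [] => 1
  | t :: ts => density t * densityProd ts
end

mutual
/-- All vertices are round. -/
def AllRound : PlaneTree N → Prop
  | round _ ts => AllRoundList ts
  | square _ _ => False
/-- All vertices of all trees of a list are round. -/
def AllRoundList : List (PlaneTree N) → Prop
  | [] => True
  | t :: ts => AllRound t ∧ AllRoundList ts
end

theorem orderSum_eq (ts : List (PlaneTree N)) : orderSum ts = (ts.map order).sum := by
  induction ts with
  | nil => simp [orderSum]
  | cons t ts ih => simp [orderSum, ih]

theorem densityProd_eq (ts : List (PlaneTree N)) :
    densityProd ts = (ts.map density).prod := by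
  induction ts with
  | nil => simp [densityProd]
  | cons t ts ih => simp [densityProd, ih]

theorem allRoundList_iff (ts : List (PlaneTree N)) :
    AllRoundList ts ↔ ∀ t ∈ ts, AllRound t := by
  induction ts with
  | nil => simp [AllRoundList]
  | cons t ts ih => simp [AllRoundList, ih]

theorem Step.order_eq {t u : PlaneTree N} (h : Step t u) : order t = order u := by
  induction h with
  | perm m h => simp only [order, orderSum_eq]; rw [(h.map order).sum_eq]
  | roundChild m l r h ih => simp [order, orderSum_eq, ih]
  | squareChild m h ih => simp [order, ih]

theorem Step.density_eq {t u : PlaneTree N} (h : Step t u) : density t = density u := by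
  induction h with
  | perm m h =>
    simp only [density, orderSum_eq, densityProd_eq]
    rw [(h.map order).sum_eq, (h.map density).prod_eq]
  | roundChild m l r h ih => simp [density, orderSum_eq, densityProd_eq, ih, h.order_eq]
  | squareChild m h ih => simp [density, ih, h.order_eq]

theorem Step.allRound_eq {t u : PlaneTree N} (h : Step t u) : AllRound t = AllRound u := by
  induction h with
  | perm m h => simp only [AllRound, allRoundList_iff, h.mem_iff]
  | roundChild m l r h ih =>
    simp only [AllRound, allRoundList_iff, List.forall_mem_append, List.forall_mem_cons, ih]
  | squareChild m h ih => simp [AllRound]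

end PlaneTree

/-- The set `TW_N`: rooted trees with round and square vertices coloured by `Fin N`, up to
reordering of the children, together with the empty tree `none`. -/
abbrev TW (N : ℕ) : Type := Option (Quot (PlaneTree.Step (N := N)))

namespace TW

variable {N : ℕ}

/-- The order `ρ(t)`, the number of vertices. -/
def order : TW N → ℕ
  | none => 0
  | some t => Quot.lift PlaneTree.order (fun _ _ h => h.order_eq) t

/-- The density `γ(t)`. -/
def density : TW N → ℕ
  | none => 1
  | some t => Quot.lift PlaneTree.density (fun _ _ h => h.density_eq) t

/-- The subset `T_N` of `TW_N`: the trees without square vertices. -/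
def IsT : TW N → Prop
  | none => True
  | some t => Quot.lift PlaneTree.AllRound (fun _ _ h => h.allRound_eq) t

end TW

/-- The coefficients of an `N`-way partitioned GARK-ROW method: numbers of stages `s q`, weights
`b q` and coefficient matrices `α q m`, `γ q m` of size `s q × s m`. -/
structure GARKROW (N : ℕ) where
  s : Fin N → ℕ
  b : ∀ q : Fin N, Fin (s q) → ℝ
  α : ∀ q m : Fin N, Matrix (Fin (s q)) (Fin (s m)) ℝ
  γ : ∀ q m : Fin N, Matrix (Fin (s q)) (Fin (s m)) ℝ

namespace GARKROW

variable {N : ℕ} (M : GARKROW N)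

/-- The stage equations of one step of size `h` from the point `y₀`, for the component functions
`f q` and the Jacobian approximations `L q`; `k q i` is the `i`-th stage of the component `q`. -/
def StageEquations {d : ℕ} (f : Fin N → (Fin d → ℝ) → (Fin d → ℝ))
    (L : Fin N → Matrix (Fin d) (Fin d) ℝ) (h : ℝ) (y₀ : Fin d → ℝ)
    (k : ∀ q : Fin N, Fin (M.s q) → (Fin d → ℝ)) : Prop :=
  ∀ (q : Fin N) (i : Fin (M.s q)),
    k q i = h • f q (y₀ + ∑ m, ∑ j, M.α q m i j • k m j)
      + h • (L q).mulVec (∑ m, ∑ j, M.γ q m i j • k m j)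

/-- The numerical solution after one step from `y₀` with stages `k`. -/
def update {d : ℕ} (y₀ : Fin d → ℝ) (k : ∀ q : Fin N, Fin (M.s q) → (Fin d → ℝ)) :
    Fin d → ℝ :=
  y₀ + ∑ q, ∑ i, M.b q i • k q i

/-- The method has order `p`: for every smooth partitioned system `y' = ∑ q, f q y`, all matrices
`L q` and every starting point on an exact solution `y`, the local error of one step of size `h`
is `O(h ^ (p + 1))` as `h → 0⁺`. For coefficient matrices without triangular structure the stage
equations are nonlinear, and the stages are those on the solution branch that tends to `0` with
`h`; for strictly lower triangular `α` and lower triangular `γ` the stages are unique for small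
`h` and tend to `0` automatically. -/
def HasOrder (p : ℕ) : Prop :=
  ∀ (d : ℕ) (f : Fin N → (Fin d → ℝ) → (Fin d → ℝ)), (∀ q, ContDiff ℝ ∞ (f q)) →
    ∀ (L : Fin N → Matrix (Fin d) (Fin d) ℝ) (t₀ : ℝ) (y : ℝ → (Fin d → ℝ)),
      (∀ᶠ t in 𝓝 t₀, HasDerivAt y (∑ q, f q (y t)) t) →
    ∀ k : ℝ → ∀ q : Fin N, Fin (M.s q) → (Fin d → ℝ),
      Tendsto k (𝓝[>] 0) (𝓝 0) →
      (∀ᶠ h in 𝓝[>] (0 : ℝ), M.StageEquations f L h (y t₀) (k h)) →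
      (fun h : ℝ => M.update (y t₀) (k h) - y (t₀ + h)) =O[𝓝[>] 0] fun h : ℝ => h ^ (p + 1)

mutual
/-- The recurrence for the stage coefficients `θ q t` of a nonempty tree: subtrees under a round
vertex are multiplied by `α`, the subtree under a square vertex by `γ`, and the coefficient is `0`
when the root does not have the colour `q`. -/
def planeTheta : PlaneTree N → ∀ q : Fin N, Fin (M.s q) → ℝ
  | .round m ts, q => if m = q then planeThetaProd ts q else 0
  | .square m t, q => if m = q then ∑ n, (M.γ q n).mulVec (planeTheta t n) else 0
/-- The element-by-element product over a list of trees of the vectors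
`∑ n, α q n * θ n t`; it is the vector of ones for the empty list. -/
def planeThetaProd : List (PlaneTree N) → ∀ q : Fin N, Fin (M.s q) → ℝ
  | [], _ => 1
  | t :: ts, q => (∑ n, (M.α q n).mulVec (planeTheta t n)) * planeThetaProd ts q
end

theorem planeThetaProd_eq (ts : List (PlaneTree N)) (q : Fin N) :
    M.planeThetaProd ts q =
      (ts.map fun t => ∑ n, (M.α q n).mulVec (M.planeTheta t n)).prod := by
  induction ts with
  | nil => simp [planeThetaProd]
  | cons t ts ih => simp [planeThetaProd, ih]

theorem planeTheta_step {t u : PlaneTree N} (h : PlaneTree.Step t u) :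
    M.planeTheta t = M.planeTheta u := by
  induction h with
  | perm m h =>
    funext q
    simp only [planeTheta, planeThetaProd_eq]
    rw [(h.map fun t => ∑ n, (M.α q n).mulVec (M.planeTheta t n)).prod_eq]
  | roundChild m l r h ih => funext q; simp [planeTheta, planeThetaProd_eq, ih]
  | squareChild m h ih => funext q; simp [planeTheta, ih]

/-- The stage coefficients `θ q t`, with `θ q ∅ = 0`. -/
def theta : TW N → ∀ q : Fin N, Fin (M.s q) → ℝ
  | none => 0
  | some t => Quot.lift M.planeTheta (fun _ _ h => M.planeTheta_step h) t

/-- The coefficients of the numerical solution: `φ(∅) = 1` and `φ(t) = ∑ q, b q ⬝ θ q t` for every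
nonempty tree, with or without square vertices. -/
noncomputable def phi : TW N → ℝ
  | none => 1
  | some t => ∑ q, ∑ i, M.b q i * M.theta (some t) q i

end GARKROW

-- Everything is done on plane trees. Expanding the `L`-th Taylor term multilinearly gives a sum
-- over ordered lists of `L` subtrees with the factor `1 / L!`, so no symmetry coefficients are
-- needed; the condition on an unordered tree is the condition on any plane representative.
--
-- Sufficiency: substituting a truncated tree series into a smooth function gives a series over
-- forests (`taylor_treesLE_isBigO`). Integrating the differential equation then raises the order of
-- the expansion of the exact solution by one, with coefficients `exactCoeff`
-- (`exact_sub_treesLE_isBigO`); the factor `h` in the stage equations does the same for the stages,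
-- with coefficients `planeTheta` (`stage_sub_treesLE_isBigO`). Both series have the same elementary
-- differentials, so equal coefficients up to order `p` leave only `O(h ^ (p + 1))`.
--
-- Necessity: for a given tree there is a polynomial system, with one unknown per tree of a finite
-- family closed under taking children, in which exact solution and stages are exact monomials
-- (`hasDerivAt_treeSystem`, `stageEquations_treeSystem`). The `L q` need not be Jacobians, so they
-- can carry the square vertices without affecting the exact flow. The coordinate of the given tree
-- isolates its order condition.

-- Taylor's formula in a normed space

section Taylor

variable {E F : Type*} [NormedAddCommGroup E] [NormedSpace ℝ E]
  [NormedAddCommGroup F] [NormedSpace ℝ F]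

theorem iteratedDeriv_comp_add_smul {f : E → F} (hf : ContDiff ℝ ∞ f) (x v : E) (n : ℕ) :
    iteratedDeriv n (fun s : ℝ => f (x + s • v)) =
      fun s => iteratedFDeriv ℝ n f (x + s • v) fun _ => v := by
  induction n with
  | zero => funext s; simp
  | succ n ih =>
    funext s
    rw [iteratedDeriv_succ, ih]
    have h1 : HasFDerivAt (iteratedFDeriv ℝ n f)
        (fderiv ℝ (iteratedFDeriv ℝ n f) (x + s • v)) (x + s • v) :=
      ((hf.differentiable_iteratedFDeriv (m := n)
        (by exact_mod_cast WithTop.coe_lt_top _)) _).hasFDerivAt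
    have h2 : HasDerivAt (fun s : ℝ => x + s • v) v s := by
      simpa using ((hasDerivAt_id s).smul_const v).const_add x
    have h3 := h1.comp_hasDerivAt s h2
    have h4 := ((ContinuousMultilinearMap.apply ℝ (fun _ : Fin n => E) F
      fun _ => v).hasFDerivAt.comp_hasDerivAt s h3).deriv
    rw [iteratedFDeriv_succ_apply_left]
    exact h4

/-- Taylor's formula with the remainder bounded by a power of the increment. -/
theorem taylor_isBigO {f : E → F} (hf : ContDiff ℝ ∞ f) (x : E) (n : ℕ) :
    (fun v => f (x + v) - ∑ L ∈ Finset.range (n + 1),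
      ((L.factorial : ℝ)⁻¹) • iteratedFDeriv ℝ L f x fun _ => v) =O[𝓝 0]
      fun v => ‖v‖ ^ (n + 1) := by
  have hc : Continuous (iteratedFDeriv ℝ (n + 1) f) :=
    hf.continuous_iteratedFDeriv (by exact_mod_cast le_top)
  -- Continuity at `x` with tolerance 1 bounds the derivative of order `n + 1` by `C` on a ball.
  -- This replaces compactness, which may fail in `E`; the scalar remainder bound is then applied
  -- along the segment from `x` to `x + v`.
  obtain ⟨ε, hε, hb⟩ := Metric.continuousAt_iff.1 (hc.continuousAt (x := x)) 1 one_pos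
  set C := ‖iteratedFDeriv ℝ (n + 1) f x‖ + 1
  refine IsBigO.of_bound (C / n.factorial) ?_
  filter_upwards [Metric.ball_mem_nhds (0 : E) hε] with v hv
  rw [mem_ball_zero_iff] at hv
  have hg : ContDiff ℝ ∞ fun s : ℝ => f (x + s • v) :=
    hf.comp (contDiff_const.add (contDiff_id.smul contDiff_const))
  have hw : ∀ m : ℕ, ∀ s ∈ Set.Icc (0 : ℝ) 1,
      iteratedDerivWithin m (fun s : ℝ => f (x + s • v)) (Set.Icc 0 1) s =
        iteratedFDeriv ℝ m f (x + s • v) fun _ => v := by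
    intro m s hs
    rw [iteratedDerivWithin_eq_iteratedDeriv (uniqueDiffOn_Icc one_pos)
      (hg.contDiffAt.of_le (by exact_mod_cast le_top)) hs, iteratedDeriv_comp_add_smul hf]
  have key := taylor_mean_remainder_bound (f := fun s : ℝ => f (x + s • v)) (a := 0) (b := 1)
    (C := C * ‖v‖ ^ (n + 1)) (x := 1) (n := n) zero_le_one
    (hg.contDiffOn.of_le (by exact_mod_cast le_top)) (by simp) (by
      intro s hs
      rw [hw _ _ hs]
      refine (ContinuousMultilinearMap.le_opNorm _ _).trans ?_
      simp only [Finset.prod_const, Finset.card_univ, Fintype.card_fin]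
      gcongr
      have h1 : dist (x + s • v) x < ε := by
        rw [dist_eq_norm, add_sub_cancel_left, norm_smul, Real.norm_of_nonneg hs.1]
        exact (mul_le_of_le_one_left (norm_nonneg _) hs.2).trans_lt hv
      have h2 := hb h1
      rw [dist_eq_norm, norm_sub_rev] at h2
      have h3 := norm_le_norm_add_norm_sub (iteratedFDeriv ℝ (n + 1) f x)
        (iteratedFDeriv ℝ (n + 1) f (x + s • v))
      simp only [C]
      linarith)
  rw [taylor_within_apply] at key
  simp only [one_smul, sub_zero, one_pow, mul_one] at key
  rw [Finset.sum_congr rfl fun L _ => by rw [hw L 0 (by simp)]] at key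
  simp only [zero_smul, add_zero] at key
  rw [Real.norm_of_nonneg (by positivity : (0 : ℝ) ≤ ‖v‖ ^ (n + 1))]
  calc _ ≤ _ := key
    _ = _ := by ring

end Taylor

-- Finite sums over trees and forests

namespace PlaneTree

variable {N : ℕ}

theorem order_pos (t : PlaneTree N) : 1 ≤ order t := by
  cases t <;> simp [order]

theorem length_le_orderSum (ts : List (PlaneTree N)) : ts.length ≤ orderSum ts := by
  induction ts with
  | nil => simp
  | cons t ts ih => simp only [List.length_cons, orderSum]; have := t.order_pos; omega

theorem order_le_orderSum {t : PlaneTree N} {ts : List (PlaneTree N)} (h : t ∈ ts) :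
    order t ≤ orderSum ts := by
  rw [orderSum_eq]
  exact List.single_le_sum (by simp) _ (List.mem_map_of_mem h)

theorem finite_orderSum_le_of_finite {n : ℕ} (hn : {t : PlaneTree N | order t ≤ n}.Finite) :
    {ts : List (PlaneTree N) | orderSum ts ≤ n}.Finite := by
  refine ((Set.finite_Iic n).biUnion fun L _ =>
    (Set.Finite.pi (ι := Fin L) fun _ => hn).image List.ofFn).subset fun ts hts => ?_
  simp only [Set.mem_iUnion]
  exact ⟨ts.length, (length_le_orderSum ts).trans hts, ts.get,
    fun i _ => (order_le_orderSum (List.get_mem ts i)).trans hts, List.ofFn_get ts⟩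

theorem finite_order_le (n : ℕ) : {t : PlaneTree N | order t ≤ n}.Finite := by
  induction n with
  | zero =>
    refine Set.finite_empty.subset fun t ht => ?_
    have := t.order_pos
    simp only [Set.mem_ofPred_eq] at ht
    omega
  | succ n ih =>
    refine ((Set.finite_univ.image2 round (finite_orderSum_le_of_finite ih)).union
      (Set.finite_univ.image2 square ih)).subset fun t ht => ?_
    cases t with
    | round m ts =>
      refine Or.inl ⟨m, trivial, ts, ?_, rfl⟩
      simp only [Set.mem_ofPred_eq, order] at ht ⊢; omega
    | square m t =>
      refine Or.inr ⟨m, trivial, t, ?_, rfl⟩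
      simp only [Set.mem_ofPred_eq, order] at ht ⊢; omega

/-- The plane trees with at most `n` vertices. -/
noncomputable def treesLE (N n : ℕ) : Finset (PlaneTree N) := (finite_order_le n).toFinset

/-- The lists of plane trees with at most `n` vertices in total. -/
noncomputable def forestsLE (N n : ℕ) : Finset (List (PlaneTree N)) :=
  (finite_orderSum_le_of_finite (finite_order_le n)).toFinset

@[simp] theorem mem_treesLE {n : ℕ} {t : PlaneTree N} : t ∈ treesLE N n ↔ order t ≤ n := by
  simp [treesLE]

@[simp] theorem mem_forestsLE {n : ℕ} {ts : List (PlaneTree N)} :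
    ts ∈ forestsLE N n ↔ orderSum ts ≤ n := by
  simp [forestsLE]

/-- A sum over trees splits according to the root. -/
theorem sum_treesLE_succ {A : Type*} [AddCommMonoid A] (n : ℕ) (F : PlaneTree N → A) :
    ∑ t ∈ treesLE N (n + 1), F t =
      ∑ m, ∑ ts ∈ forestsLE N n, F (round m ts) + ∑ m, ∑ t ∈ treesLE N n, F (square m t) := by
  classical
  have h : treesLE N (n + 1) =
      (Finset.univ ×ˢ forestsLE N n).image (fun x => round x.1 x.2) ∪
        (Finset.univ ×ˢ treesLE N n).image (fun x => square x.1 x.2) := by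
    ext t
    cases t with
    | round m ts => simp [order, add_comm 1]
    | square m t => simp [order, add_comm 1]
  rw [h, Finset.sum_union, Finset.sum_image, Finset.sum_image, Finset.sum_product,
    Finset.sum_product]
  · rintro ⟨m, t⟩ _ ⟨m', t'⟩ _ h
    simpa using h
  · rintro ⟨m, t⟩ _ ⟨m', t'⟩ _ h
    simpa using h
  · simp only [Finset.disjoint_left, Finset.mem_image, not_exists, not_and]
    rintro _ ⟨x, -, rfl⟩ y - h
    cases h

/-- The lists of length at most `n` of trees with at most `n` vertices each. -/
noncomputable def tuplesLE (N n : ℕ) : Finset (Σ L : ℕ, Fin L → PlaneTree N) :=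
  (Finset.range (n + 1)).sigma fun _ => Fintype.piFinset fun _ => treesLE N n

/-- Multilinear expansion produces all tuples of at most `n` trees of order at most `n`. These
include every forest of total order at most `n`; the surplus `S` has higher total order and will go
into the remainder. -/
theorem sum_tuplesLE {A : Type*} [AddCommGroup A] (n : ℕ) (F : List (PlaneTree N) → A) :
    ∃ S : Finset (List (PlaneTree N)), (∀ ts ∈ S, n + 1 ≤ orderSum ts) ∧
      ∑ L ∈ Finset.range (n + 1), ∑ r ∈ Fintype.piFinset (fun _ : Fin L => treesLE N n),
        F (List.ofFn r) = ∑ ts ∈ forestsLE N n, F ts + ∑ ts ∈ S, F ts := by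
  classical
  set B : Finset (List (PlaneTree N)) := (tuplesLE N n).image fun x => List.ofFn x.2 with hB
  have hsub : forestsLE N n ⊆ B := by
    intro ts hts
    rw [mem_forestsLE] at hts
    refine Finset.mem_image.2 ⟨⟨ts.length, ts.get⟩, ?_, List.ofFn_get ts⟩
    simp only [tuplesLE, Finset.mem_sigma, Finset.mem_range, Fintype.mem_piFinset, mem_treesLE]
    exact ⟨Nat.lt_succ_of_le ((length_le_orderSum ts).trans hts),
      fun i => (order_le_orderSum (List.get_mem ts i)).trans hts⟩
  refine ⟨B \ forestsLE N n, fun ts hts => ?_, ?_⟩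
  · simp only [Finset.mem_sdiff, mem_forestsLE] at hts
    omega
  · rw [add_comm (∑ ts ∈ forestsLE N n, F ts), Finset.sum_sdiff hsub, hB, Finset.sum_image, tuplesLE, Finset.sum_sigma]
    rintro ⟨L, r⟩ _ ⟨L', r'⟩ _ h
    exact List.ofFn_inj'.1 h

end PlaneTree

-- Composition of a smooth function with a truncated tree series

section Expansion

variable {E : Type*} [NormedAddCommGroup E] [NormedSpace ℝ E]

/-- The Taylor coefficient of `f` at `x`, applied to a list of directions. -/
noncomputable def taylorCoeff (f : E → E) (x : E) (vs : List E) : E :=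
  ((vs.length.factorial : ℝ)⁻¹) • iteratedFDeriv ℝ vs.length f x vs.get

theorem taylorCoeff_ofFn (f : E → E) (x : E) {L : ℕ} (v : Fin L → E) :
    taylorCoeff f x (List.ofFn v) = ((L.factorial : ℝ)⁻¹) • iteratedFDeriv ℝ L f x v := by
  -- The length of `List.ofFn v` equals `L` only propositionally; comparing pairs in the sigma type
  -- avoids casts.
  have key : ∀ p q : Σ L : ℕ, Fin L → E, p = q →
      ((p.1.factorial : ℝ)⁻¹) • iteratedFDeriv ℝ p.1 f x p.2 =
        ((q.1.factorial : ℝ)⁻¹) • iteratedFDeriv ℝ q.1 f x q.2 := by rintro p _ rfl; rfl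
  exact key ⟨_, (List.ofFn v).get⟩ ⟨L, v⟩ (List.equivSigmaTuple.right_inv ⟨L, v⟩)

open PlaneTree

variable {N : ℕ} {l : Filter ℝ}

theorem isBigO_pow_of_le (hl : Tendsto id l (𝓝 0)) {m n : ℕ} (h : m ≤ n) :
    (fun x : ℝ => x ^ n) =O[l] fun x : ℝ => x ^ m := by
  have h1 : (fun x : ℝ => x ^ (n - m)) =O[l] fun _ => (1 : ℝ) := (hl.pow (n - m)).isBigO_one ℝ
  refine ((isBigO_refl (fun x : ℝ => x ^ m) l).mul h1).congr (fun x => ?_) fun x => mul_one _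
  rw [← pow_add, Nat.add_sub_cancel' h]

theorem isBigO_pow_smul (hl : Tendsto id l (𝓝 0)) {m n : ℕ} (h : m ≤ n) (c : ℝ) (v : E) :
    (fun x : ℝ => (x ^ n * c) • v) =O[l] fun x : ℝ => x ^ m := by
  have h1 : (fun x : ℝ => (x ^ n * c) • v) =O[l] fun x : ℝ => x ^ n := by
    refine IsBigO.of_bound (‖c‖ * ‖v‖) (Eventually.of_forall fun x => ?_)
    rw [norm_smul, norm_mul]
    exact le_of_eq (by ring)
  exact h1.trans (isBigO_pow_of_le hl h)

/-- Substituting a truncated tree series into a smooth function yields a sum over forests. -/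
theorem taylor_treesLE_isBigO (hl : Tendsto id l (𝓝 0)) {f : E → E} (hf : ContDiff ℝ ∞ f) (x : E)
    (n : ℕ) (a : PlaneTree N → ℝ) (G : PlaneTree N → E) {δ : ℝ → E}
    (hδ : (fun h => δ h - ∑ t ∈ treesLE N n, (h ^ order t * a t) • G t) =O[l]
      fun h => h ^ (n + 1)) :
    (fun h => f (x + δ h) - ∑ ts ∈ forestsLE N n,
      (h ^ orderSum ts * (ts.map a).prod) • taylorCoeff f x (ts.map G)) =O[l]
      fun h => h ^ (n + 1) := by
  set P : ℝ → E := fun h => ∑ t ∈ treesLE N n, (h ^ order t * a t) • G t with hP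
  have hPO : P =O[l] fun h => h ^ 1 :=
    IsBigO.fun_sum fun t _ => isBigO_pow_smul hl t.order_pos _ _
  have hδO : δ =O[l] fun h => h ^ 1 := by
    exact ((hδ.trans (isBigO_pow_of_le hl (Nat.le_add_left 1 n))).add hPO).congr_left
      fun h => sub_add_cancel _ _
  simp only [pow_one] at hPO hδO
  have hδ0 : Tendsto δ l (𝓝 0) := hδO.trans_tendsto hl
  have h1 : (fun h => f (x + δ h) - ∑ L ∈ Finset.range (n + 1),
      ((L.factorial : ℝ)⁻¹) • iteratedFDeriv ℝ L f x fun _ => δ h) =O[l]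
      fun h => h ^ (n + 1) :=
    ((taylor_isBigO hf x n).comp_tendsto hδ0).trans (hδO.norm_left.pow (n + 1))
  -- Replacing `δ` by its truncation `P` is harmless: multilinear maps are Lipschitz on bounded sets
  -- and `δ - P` is already `O(h ^ (n + 1))`.
  have h2 : (fun h => ∑ L ∈ Finset.range (n + 1),
      ((L.factorial : ℝ)⁻¹) • (iteratedFDeriv ℝ L f x (fun _ => δ h)
        - iteratedFDeriv ℝ L f x (fun _ => P h))) =O[l] fun h => h ^ (n + 1) := by
    refine IsBigO.fun_sum fun L _ => IsBigO.const_smul_left ?_ _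
    set A := iteratedFDeriv ℝ L f x
    have h3 : (fun h => A (fun _ => δ h) - A (fun _ => P h)) =O[l]
        fun h => ‖A‖ * L * max ‖fun _ : Fin L => δ h‖ ‖fun _ : Fin L => P h‖ ^ (L - 1) *
          ‖(fun _ : Fin L => δ h) - fun _ => P h‖ := by
      refine IsBigO.of_bound 1 (Eventually.of_forall fun h => ?_)
      have := A.norm_image_sub_le (fun _ => δ h) (fun _ => P h)
      rw [Fintype.card_fin] at this
      rw [one_mul]
      exact this.trans (le_abs_self _)
    refine h3.trans ?_
    have h4 : (fun h => ‖A‖ * L * max ‖fun _ : Fin L => δ h‖ ‖fun _ : Fin L => P h‖ ^ (L - 1))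
        =O[l] fun _ => (1 : ℝ) := by
      have hb : ∀ u : ℝ → E, u =O[l] (fun h => h) → Tendsto (fun h => ‖fun _ : Fin L => u h‖) l
          (𝓝 0) := fun u hu => by
        have h0 : Tendsto (fun h (_ : Fin L) => u h) l (𝓝 0) :=
          tendsto_pi_nhds.2 fun _ => hu.trans_tendsto hl
        simpa only [norm_zero] using h0.norm
      exact (((hb δ hδO).max (hb P hPO)).pow (L - 1)).const_mul (‖A‖ * L) |>.isBigO_one ℝ
    have h5 : (fun h => ‖(fun _ : Fin L => δ h) - fun _ => P h‖) =O[l] fun h => h ^ (n + 1) :=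
      (isBigO_pi.2 fun _ => hδ).norm_left
    simpa using h4.mul h5
  obtain ⟨S, hS, hsum⟩ : ∃ S : Finset (List (PlaneTree N)), (∀ ts ∈ S, n + 1 ≤ orderSum ts) ∧
      ∀ h : ℝ, ∑ L ∈ Finset.range (n + 1), ((L.factorial : ℝ)⁻¹) •
          iteratedFDeriv ℝ L f x (fun _ => P h) =
        ∑ ts ∈ forestsLE N n,
          (h ^ orderSum ts * (ts.map a).prod) • taylorCoeff f x (ts.map G) +
        ∑ ts ∈ S, (h ^ orderSum ts * (ts.map a).prod) • taylorCoeff f x (ts.map G) := by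
    -- The summands are taken as functions of `h`, so that a single `S` serves all `h`.
    obtain ⟨S, hS, hsum⟩ := sum_tuplesLE n fun ts : List (PlaneTree N) => fun h : ℝ =>
      (h ^ orderSum ts * (ts.map a).prod) • taylorCoeff f x (ts.map G)
    refine ⟨S, hS, fun h => ?_⟩
    have := congrFun hsum h
    simp only [Finset.sum_apply, Pi.add_apply] at this
    rw [← this]
    refine Finset.sum_congr rfl fun L _ => ?_
    have hms := (iteratedFDeriv ℝ L f x).toMultilinearMap.map_sum_finset
      (fun (_ : Fin L) t => (h ^ order t * a t) • G t) (fun _ => treesLE N n)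
    simp only [ContinuousMultilinearMap.coe_coe] at hms
    rw [hP, hms, Finset.smul_sum]
    refine Finset.sum_congr rfl fun r _ => ?_
    rw [ContinuousMultilinearMap.map_smul_univ, List.map_ofFn, List.map_ofFn, taylorCoeff_ofFn,
      orderSum_eq, List.map_ofFn, List.sum_ofFn, List.prod_ofFn, Finset.prod_mul_distrib,
      Finset.prod_pow_eq_pow_sum, smul_comm]
    rfl
  have h6 : (fun h : ℝ => ∑ ts ∈ S, (h ^ orderSum ts * (ts.map a).prod) •
      taylorCoeff f x (ts.map G)) =O[l] fun h => h ^ (n + 1) :=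
    IsBigO.fun_sum fun ts hts => isBigO_pow_smul hl (hS ts hts) _ _
  refine ((h1.add h2).add h6).congr_left fun h => ?_
  simp only [smul_sub, Finset.sum_sub_distrib, hsum]
  abel

end Expansion

-- Elementary differentials and coefficients of the exact solution

namespace PlaneTree

variable {N d : ℕ}

section ElementaryDifferential

variable (f : Fin N → (Fin d → ℝ) → (Fin d → ℝ)) (L : Fin N → Matrix (Fin d) (Fin d) ℝ)
  (x : Fin d → ℝ)

mutual
/-- The elementary differential of a plane tree, with the factors `1 / L!` of the Taylor
coefficients included. -/
noncomputable def elemDiff : PlaneTree N → (Fin d → ℝ)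
  | round m ts => taylorCoeff (f m) x (elemDiffList ts)
  | square m t => (L m).mulVec (elemDiff t)
/-- The elementary differentials of a list of trees. -/
noncomputable def elemDiffList : List (PlaneTree N) → List (Fin d → ℝ)
  | [] => []
  | t :: ts => elemDiff t :: elemDiffList ts
end

theorem elemDiffList_eq (ts : List (PlaneTree N)) :
    elemDiffList f L x ts = ts.map (elemDiff f L x) := by
  induction ts with
  | nil => simp [elemDiffList]
  | cons t ts ih => simp [elemDiffList, ih]

end ElementaryDifferential

open Classical in
/-- The coefficients of the exact solution. -/
noncomputable def exactCoeff (t : PlaneTree N) : ℝ := if AllRound t then 1 / (density t : ℝ) else 0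

theorem exactCoeff_square (m : Fin N) (t : PlaneTree N) : exactCoeff (square m t) = 0 := by
  simp [exactCoeff, AllRound]

-- The prefactor `1 / ρ(t)` is what cancels the factor produced by differentiating `h ^ ρ(t)`; the
-- product over the children vanishes as soon as one of them contains a square vertex.
open Classical in
theorem exactCoeff_round (m : Fin N) (ts : List (PlaneTree N)) :
    exactCoeff (round m ts) = ((1 + orderSum ts : ℕ) : ℝ)⁻¹ * (ts.map exactCoeff).prod := by
  have h : (ts.map exactCoeff).prod =
      if ∀ t ∈ ts, AllRound t then ((densityProd ts : ℕ) : ℝ)⁻¹ else 0 := by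
    clear m
    induction ts with
    | nil => simp [densityProd]
    | cons t ts ih =>
      rw [List.map_cons, List.prod_cons, ih]
      by_cases h1 : AllRound t <;> by_cases h2 : ∀ t ∈ ts, AllRound t <;>
        simp [exactCoeff, h1, h2, densityProd, mul_comm]
  rw [h]
  simp only [exactCoeff, AllRound, allRoundList_iff, density]
  split_ifs <;> simp [mul_comm]

end PlaneTree

-- Expansion of the exact solution

section Integration

variable {E : Type*} [NormedAddCommGroup E] [NormedSpace ℝ E]

/-- Mean value inequality on the ball of radius `‖h‖`, where the derivative is bounded by `C * ‖h‖ ^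
n`. -/
theorem isBigO_pow_succ_of_hasDerivAt {r r' : ℝ → E} {n : ℕ} (h0 : r 0 = 0)
    (hr : ∀ᶠ h in 𝓝 (0 : ℝ), HasDerivAt r (r' h) h) (hO : r' =O[𝓝 0] fun h => h ^ n) :
    r =O[𝓝 0] fun h => h ^ (n + 1) := by
  obtain ⟨C, hC0, hC⟩ := hO.exists_nonneg
  obtain ⟨ε, hε, hb⟩ := Metric.eventually_nhds_iff.1 (hr.and hC.bound)
  refine IsBigO.of_bound C (Metric.eventually_nhds_iff.2 ⟨ε, hε, fun h hh => ?_⟩)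
  have hs : ∀ s ∈ Metric.closedBall (0 : ℝ) ‖h‖, dist s 0 < ε := fun s hs =>
    (by simpa using hs : dist s 0 ≤ dist h 0).trans_lt hh
  have := Convex.norm_image_sub_le_of_norm_hasDerivWithin_le (C := C * ‖h‖ ^ n)
    (fun s h1 => (hb (hs s h1)).1.hasDerivWithinAt)
    (fun s h1 => ((hb (hs s h1)).2).trans (by
      rw [norm_pow]
      gcongr
      simpa using h1))
    (convex_closedBall (0 : ℝ) ‖h‖) (Metric.mem_closedBall_self (norm_nonneg h))
    (by simp : h ∈ Metric.closedBall (0 : ℝ) ‖h‖)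
  rw [h0, sub_zero, sub_zero] at this
  calc ‖r h‖ ≤ _ := this
    _ = _ := by rw [norm_pow]; ring

end Integration

open PlaneTree

variable {N d : ℕ}

/-- The expansion of the exact solution as a tree series. -/
theorem exact_sub_treesLE_isBigO {f : Fin N → (Fin d → ℝ) → (Fin d → ℝ)}
    (hf : ∀ q, ContDiff ℝ ∞ (f q)) (L : Fin N → Matrix (Fin d) (Fin d) ℝ) {t₀ : ℝ}
    {y : ℝ → (Fin d → ℝ)} (hy : ∀ᶠ t in 𝓝 t₀, HasDerivAt y (∑ q, f q (y t)) t) (n : ℕ) :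
    (fun h => (y (t₀ + h) - y t₀) - ∑ t ∈ treesLE N n,
      (h ^ order t * exactCoeff t) • elemDiff f L (y t₀) t) =O[𝓝 0] fun h => h ^ (n + 1) := by
  set G := elemDiff f L (y t₀) with hG
  have hy' : ∀ᶠ h in 𝓝 (0 : ℝ), HasDerivAt (fun h => y (t₀ + h)) (∑ q, f q (y (t₀ + h))) h := by
    have hc : Tendsto (fun h : ℝ => t₀ + h) (𝓝 0) (𝓝 t₀) := by
      have : ContinuousAt (fun h : ℝ => t₀ + h) 0 := by fun_prop
      simpa [ContinuousAt] using this
    filter_upwards [hc.eventually hy] with h hh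
    exact hh.comp_const_add t₀ h
  induction n with
  | zero =>
    have h1 := hy'.self_of_nhds.isBigO_sub
    have h2 : treesLE N 0 = ∅ := by
      ext t
      have := t.order_pos
      simp only [mem_treesLE, Finset.notMem_empty, iff_false]
      omega
    simpa [h2] using h1
  | succ n ih =>
    -- The derivative of the remainder at level `n + 1` is the composition remainder at level `n`.
    -- Writing the solution as `y t₀` plus an increment lets the induction hypothesis supply the
    -- expansion of that increment.
    refine isBigO_pow_succ_of_hasDerivAt (r' := fun h => ∑ q, (f q (y t₀ + (y (t₀ + h) - y t₀)) -
      ∑ ts ∈ forestsLE N n, (h ^ orderSum ts * (ts.map exactCoeff).prod) •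
        taylorCoeff (f q) (y t₀) (ts.map G))) ?_ ?_
      (IsBigO.fun_sum fun q _ => taylor_treesLE_isBigO tendsto_id (hf q) (y t₀) n exactCoeff G ih)
    · simp only [add_zero, sub_self, zero_sub, neg_eq_zero]
      refine Finset.sum_eq_zero fun t _ => ?_
      rw [zero_pow (by have := t.order_pos; omega)]
      simp
    · filter_upwards [hy'] with h hh
      have h1 : HasDerivAt (fun h => ∑ t ∈ treesLE N (n + 1), (h ^ order t * exactCoeff t) • G t)
          (∑ t ∈ treesLE N (n + 1), (((order t : ℝ) * h ^ (order t - 1)) * exactCoeff t) • G t) h :=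
        HasDerivAt.fun_sum fun t _ => ((hasDerivAt_pow _ h).mul_const _).smul_const _
      refine ((hh.sub_const (y t₀)).sub h1).congr_deriv ?_
      rw [sum_treesLE_succ]
      simp only [add_sub_cancel, exactCoeff_square, mul_zero, zero_smul, Finset.sum_const_zero,
        add_zero, Finset.sum_sub_distrib]
      congr 1
      refine Finset.sum_congr rfl fun m _ => Finset.sum_congr rfl fun ts _ => ?_
      rw [exactCoeff_round, hG, elemDiff, elemDiffList_eq, order, Nat.add_sub_cancel_left]
      congr 1
      have : ((1 + orderSum ts : ℕ) : ℝ) ≠ 0 := by positivity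
      field_simp

-- Expansion of the stages and sufficiency

namespace GARKROW

variable (M : GARKROW N)

/-- Linear combinations of the stages inherit a tree expansion. -/
theorem sum_smul_stage_isBigO {ι : Type*} {s : Fin N → ℕ} {l : Filter ℝ} {n : ℕ}
    (T : Finset ι) (w : ι → ℝ → ℝ) (G : ι → Fin d → ℝ) (θ : ι → ∀ q, Fin (s q) → ℝ)
    {k : ℝ → ∀ q : Fin N, Fin (s q) → (Fin d → ℝ)}
    (hk : ∀ q i, (fun h => k h q i - ∑ t ∈ T, (w t h * θ t q i) • G t) =O[l] fun h => h ^ n)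
    (c : ∀ q, Fin (s q) → ℝ) :
    (fun h => ∑ q, ∑ i, c q i • k h q i - ∑ t ∈ T, (w t h * ∑ q, ∑ i, c q i * θ t q i) • G t)
      =O[l] fun h => h ^ n := by
  have h1 : (fun h => ∑ q, ∑ i, c q i • (k h q i - ∑ t ∈ T, (w t h * θ t q i) • G t)) =O[l]
      fun h => h ^ n :=
    IsBigO.fun_sum fun q _ => IsBigO.fun_sum fun i _ => (hk q i).const_smul_left (c q i)
  refine h1.congr_left fun h => ?_
  simp only [smul_sub, Finset.sum_sub_distrib, Finset.mul_sum, Finset.sum_smul, Finset.smul_sum]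
  congr 1
  rw [Finset.sum_comm' (t' := Finset.univ) (s' := fun _ => T) (by simp)]
  refine Finset.sum_congr rfl fun q _ => ?_
  rw [Finset.sum_comm]
  refine Finset.sum_congr rfl fun i _ => Finset.sum_congr rfl fun t _ => ?_
  rw [smul_smul]
  congr 1
  ring

theorem sum_mulVec_apply {s : Fin N → ℕ} {r : ℕ} (A : ∀ m, Matrix (Fin r) (Fin (s m)) ℝ)
    (v : ∀ m, Fin (s m) → ℝ) (i : Fin r) :
    (∑ m, (A m).mulVec (v m)) i = ∑ m, ∑ j, A m i j * v m j := by
  simp [Finset.sum_apply, Matrix.mulVec, dotProduct]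

theorem planeThetaProd_apply (ts : List (PlaneTree N)) (q : Fin N) (i : Fin (M.s q)) :
    M.planeThetaProd ts q i =
      (ts.map fun t => ∑ m, ∑ j, M.α q m i j * M.planeTheta t m j).prod := by
  induction ts with
  | nil => simp [planeThetaProd]
  | cons t ts ih => simp [planeThetaProd, ih, Matrix.mulVec, dotProduct]

/-- The tree series reproduces the stage equations: removing a round root leaves a forest under `f
q`, removing a square root a tree under `L q`, and roots of colours other than `q` contribute
nothing. -/
theorem sum_treesLE_succ_planeTheta (f : Fin N → (Fin d → ℝ) → (Fin d → ℝ))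
    (L : Fin N → Matrix (Fin d) (Fin d) ℝ) (x : Fin d → ℝ) (n : ℕ) (h : ℝ) (q : Fin N)
    (i : Fin (M.s q)) :
    ∑ t ∈ treesLE N (n + 1), (h ^ order t * M.planeTheta t q i) • elemDiff f L x t =
      h • ∑ ts ∈ forestsLE N n, (h ^ orderSum ts *
        (ts.map fun t => ∑ m, ∑ j, M.α q m i j * M.planeTheta t m j).prod) •
          taylorCoeff (f q) x (ts.map (elemDiff f L x)) +
      h • (L q).mulVec (∑ t ∈ treesLE N n,
        (h ^ order t * ∑ m, ∑ j, M.γ q m i j * M.planeTheta t m j) • elemDiff f L x t) := by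
  rw [sum_treesLE_succ]
  congr 1
  · rw [Finset.sum_eq_single q, Finset.smul_sum]
    · refine Finset.sum_congr rfl fun ts _ => ?_
      rw [order, planeTheta, if_pos rfl, planeThetaProd_apply, elemDiff, elemDiffList_eq, smul_smul, pow_add,
        pow_one, mul_assoc]
    · intro m _ hm
      refine Finset.sum_eq_zero fun ts _ => ?_
      simp [planeTheta, hm]
    · simp
  · rw [Finset.sum_eq_single q, Matrix.mulVec_sum, Finset.smul_sum]
    · refine Finset.sum_congr rfl fun t _ => ?_
      rw [order, planeTheta, if_pos rfl, sum_mulVec_apply, elemDiff, Matrix.mulVec_smul, smul_smul,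
        pow_add, pow_one, mul_assoc]
    · intro m _ hm
      refine Finset.sum_eq_zero fun ts _ => ?_
      simp [planeTheta, hm]
    · simp

/-- The expansion of the stages as tree series. -/
theorem stage_sub_treesLE_isBigO {f : Fin N → (Fin d → ℝ) → (Fin d → ℝ)}
    (hf : ∀ q, ContDiff ℝ ∞ (f q)) (L : Fin N → Matrix (Fin d) (Fin d) ℝ) (x : Fin d → ℝ)
    {k : ℝ → ∀ q : Fin N, Fin (M.s q) → (Fin d → ℝ)} (hk : Tendsto k (𝓝[>] 0) (𝓝 0))
    (hst : ∀ᶠ h in 𝓝[>] (0 : ℝ), M.StageEquations f L h x (k h)) (n : ℕ) (q : Fin N)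
    (i : Fin (M.s q)) :
    (fun h => k h q i - ∑ t ∈ treesLE N n,
      (h ^ order t * M.planeTheta t q i) • elemDiff f L x t) =O[𝓝[>] 0] fun h => h ^ (n + 1) := by
  have hl : Tendsto id (𝓝[>] (0 : ℝ)) (𝓝 0) := nhdsWithin_le_nhds
  induction n generalizing q i with
  | zero =>
    have h2 : treesLE N 0 = ∅ := by
      ext t
      have := t.order_pos
      simp only [mem_treesLE, Finset.notMem_empty, iff_false]
      omega
    simp only [h2, Finset.sum_empty, sub_zero, zero_add, pow_one]
    have hk' : ∀ m j, Tendsto (fun h => k h m j) (𝓝[>] 0) (𝓝 0) := fun m j =>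
      tendsto_pi_nhds.1 (tendsto_pi_nhds.1 hk m) j
    have hs : ∀ c : ∀ m, Fin (M.s m) → ℝ,
        Tendsto (fun h => ∑ m, ∑ j, c m j • k h m j) (𝓝[>] 0) (𝓝 0) := fun c => by
      have := tendsto_finsetSum Finset.univ fun m _ =>
        tendsto_finsetSum Finset.univ fun j _ => (hk' m j).const_smul (c m j)
      simpa using this
    -- The bracket multiplied by `h` in the stage equation converges, hence is bounded, so the
    -- stages are `O(h)`. Only here is `k → 0` needed; afterwards each use of the stage equations
    -- gains one power of `h`.
    have h3 : Tendsto (fun h => f q (x + ∑ m, ∑ j, M.α q m i j • k h m j) +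
        (L q).mulVec (∑ m, ∑ j, M.γ q m i j • k h m j)) (𝓝[>] 0)
        (𝓝 (f q (x + 0) + (L q).mulVec 0)) :=
      (((hf q).continuous.tendsto _).comp ((hs fun m j => M.α q m i j).const_add x)).add
        (((LinearMap.toContinuousLinearMap (L q).mulVecLin).continuous.tendsto 0).comp
          (hs fun m j => M.γ q m i j))
    have h4 := (isBigO_refl (fun h : ℝ => h) (𝓝[>] 0)).smul (h3.isBigO_one ℝ)
    refine (h4.congr' ?_ (Eventually.of_forall fun h => by simp))
    filter_upwards [hst] with h hh
    rw [hh q i, smul_add]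
  | succ n ih =>
    have hf' := taylor_treesLE_isBigO hl (hf q) x n
      (fun t => ∑ m, ∑ j, M.α q m i j * M.planeTheta t m j) (elemDiff f L x)
      (sum_smul_stage_isBigO (treesLE N n) (fun t h => h ^ order t) _ M.planeTheta ih
        fun m j => M.α q m i j)
    have hL := ((LinearMap.toContinuousLinearMap (L q).mulVecLin).isBigO_comp _ _).trans
      (sum_smul_stage_isBigO (treesLE N n) (fun t h => h ^ order t) _ M.planeTheta ih
        fun m j => M.γ q m i j)
    have h1 := (isBigO_refl (fun h : ℝ => h) (𝓝[>] 0)).smul (hf'.add hL)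
    refine h1.congr' ?_ (Eventually.of_forall fun h => by simp only [smul_eq_mul]; ring)
    filter_upwards [hst] with h hh
    rw [hh q i, sum_treesLE_succ_planeTheta]
    simp only [map_sub, LinearMap.coe_toContinuousLinearMap', Matrix.mulVecLin_apply, smul_add,
      smul_sub]
    abel

theorem hasOrder_of_planeTheta {p : ℕ}
    (H : ∀ t : PlaneTree N, order t ≤ p →
      ∑ q, ∑ i, M.b q i * M.planeTheta t q i = exactCoeff t) : M.HasOrder p := by
  intro d f hf L t₀ y hy k hk hst
  have h1 := sum_smul_stage_isBigO (treesLE N p) (fun t h => h ^ order t) _ M.planeTheta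
    (M.stage_sub_treesLE_isBigO hf L (y t₀) hk hst p) M.b
  have h2 := (exact_sub_treesLE_isBigO hf L hy p).mono (nhdsWithin_le_nhds (s := Set.Ioi 0))
  refine (h1.sub h2).congr_left fun h => ?_
  have h3 : ∑ t ∈ treesLE N p, (h ^ order t * ∑ q, ∑ i, M.b q i * M.planeTheta t q i) •
      elemDiff f L (y t₀) t =
      ∑ t ∈ treesLE N p, (h ^ order t * exactCoeff t) • elemDiff f L (y t₀) t :=
    Finset.sum_congr rfl fun t ht => by rw [H t (mem_treesLE.1 ht)]
  simp only [update, h3]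
  abel

end GARKROW

-- Necessity: a system realizing a given tree

namespace PlaneTree

variable {N : ℕ}

/-- The subtrees attached to the root. -/
def children : PlaneTree N → List (PlaneTree N)
  | round _ ts => ts
  | square _ t => [t]

theorem order_lt_of_mem_children {t u : PlaneTree N} (h : u ∈ children t) : order u < order t := by
  cases t with
  | round m ts => have := order_le_orderSum (ts := ts) h; simp only [order]; omega
  | square m t => simp only [children, List.mem_singleton] at h; subst h; simp only [order]; omega

/-- Every tree lies in a finite family of trees that contains the children of its members. -/
theorem exists_fin_family (t : PlaneTree N) :
    ∃ (d : ℕ) (v : Fin d → PlaneTree N) (idx : PlaneTree N → Fin d),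
      v (idx t) = t ∧ ∀ i, ∀ c ∈ children (v i), v (idx c) = c := by
  classical
  have ht : t ∈ treesLE N (order t) := mem_treesLE.2 le_rfl
  set S := treesLE N (order t)
  -- Trees outside `S` get the index of `t` as a dummy value.
  let idx : PlaneTree N → Fin S.card := fun u =>
    if h : u ∈ S then S.equivFin ⟨u, h⟩ else S.equivFin ⟨t, ht⟩
  have hidx : ∀ u ∈ S, (S.equivFin.symm (idx u) : PlaneTree N) = u := fun u hu => by
    simp [idx, hu]
  refine ⟨S.card, fun i => S.equivFin.symm i, idx, hidx t ht, fun i c hc => hidx c ?_⟩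
  have h1 := order_lt_of_mem_children hc
  have h2 := mem_treesLE.1 (S.equivFin.symm i).2
  exact mem_treesLE.2 (h1.le.trans h2)

end PlaneTree

open PlaneTree

variable {N d : ℕ}

section TreeSystem

variable (v : Fin d → PlaneTree N) (idx : PlaneTree N → Fin d)

/-- The polynomial system with one unknown for each tree of a family, in which the unknown of a
tree with a round root is driven by the product of the unknowns of the children. -/
noncomputable def treeField (q : Fin N) (y : Fin d → ℝ) (i : Fin d) : ℝ :=
  match v i with
  | .round m ts => if m = q then (ts.map fun c => y (idx c)).prod else 0
  | .square _ _ => 0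

/-- The matrices that couple the unknown of a tree with a square root to that of its child. -/
def treeMatrix (q : Fin N) : Matrix (Fin d) (Fin d) ℝ := Matrix.of fun i =>
  match v i with
  | .round _ _ => 0
  | .square m c => if m = q then Pi.single (idx c) 1 else 0

theorem contDiff_treeField (q : Fin N) : ContDiff ℝ ∞ (treeField v idx q) := by
  refine contDiff_pi.2 fun i => ?_
  unfold treeField
  rcases v i with ⟨m, ts⟩ | ⟨m, c⟩
  · dsimp only
    split_ifs
    · induction ts with
      | nil => simpa using contDiff_const
      | cons t ts ih =>
        simp only [List.map_cons, List.prod_cons]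
        exact (contDiff_apply ℝ ℝ (idx t)).mul ih
    · exact contDiff_const
  · exact contDiff_const

variable {v idx}

/-- The weight `h ^ order` is multiplicative over the children. The coefficient `a` is kept general
because it is `exactCoeff` for the exact flow and `α` applied to `planeTheta` for the stages. -/
theorem treeField_apply_round
    (hv : ∀ i, ∀ c ∈ children (v i), v (idx c) = c) {i : Fin d} {m : Fin N} {ts : List (PlaneTree N)}
    (hi : v i = .round m ts) (q : Fin N) (h : ℝ) (a : PlaneTree N → ℝ) :
    treeField v idx q (fun j => h ^ order (v j) * a (v j)) i =
      if m = q then h ^ orderSum ts * (ts.map a).prod else 0 := by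
  have hc := hv i
  rw [hi] at hc
  simp only [children] at hc
  unfold treeField
  rw [hi]
  dsimp only
  congr 1
  clear hi
  induction ts with
  | nil => simp [orderSum]
  | cons t ts ih =>
    rw [List.map_cons, List.prod_cons, ih fun c h => hc c (List.mem_cons_of_mem t h),
      hc t List.mem_cons_self, List.map_cons, List.prod_cons, orderSum, pow_add]
    ring

/-- Round unknowns follow the recursion for `exactCoeff`. Unknowns of square-rooted trees have zero
right-hand side and zero coefficient, so they stay at 0. -/
theorem hasDerivAt_treeSystem
    (hv : ∀ i, ∀ c ∈ children (v i), v (idx c) = c) (h : ℝ) :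
    HasDerivAt (fun (s : ℝ) (j : Fin d) => s ^ order (v j) * exactCoeff (v j))
      (∑ q, treeField v idx q fun j => h ^ order (v j) * exactCoeff (v j)) h := by
  refine hasDerivAt_pi.2 fun i => ?_
  refine ((hasDerivAt_pow (order (v i)) h).mul_const (exactCoeff (v i))).congr_deriv ?_
  rw [Finset.sum_apply]
  rcases hi : v i with ⟨m, ts⟩ | ⟨m, c⟩
  · simp only [treeField_apply_round hv hi]
    rw [Finset.sum_ite_eq, if_pos (Finset.mem_univ m), exactCoeff_round, order,
      Nat.add_sub_cancel_left]
    have : ((1 + orderSum ts : ℕ) : ℝ) ≠ 0 := by positivity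
    field_simp
  · simp [exactCoeff_square, treeField, hi]

namespace GARKROW

variable (M : GARKROW N)

/-- In each coordinate the stage equation is the recurrence for `planeTheta` times a power of `h`,
so the monomials solve it exactly, for every `h`. -/
theorem stageEquations_treeSystem
    (hv : ∀ i, ∀ c ∈ children (v i), v (idx c) = c) (h : ℝ) :
    M.StageEquations (treeField v idx) (treeMatrix v idx) h 0
      fun q i j => h ^ order (v j) * M.planeTheta (v j) q i := by
  have hs : ∀ c : ∀ m, Fin (M.s m) → ℝ,
      (∑ m, ∑ j, c m j • fun l => h ^ order (v l) * M.planeTheta (v l) m j) =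
        fun l => h ^ order (v l) * ∑ m, ∑ j, c m j * M.planeTheta (v l) m j := by
    intro c
    funext l
    simp only [Finset.sum_apply, Pi.smul_apply, smul_eq_mul, Finset.mul_sum]
    exact Finset.sum_congr rfl fun m _ => Finset.sum_congr rfl fun j _ => by ring
  intro q i
  funext l
  rw [hs, hs, zero_add]
  simp only [Pi.add_apply, Pi.smul_apply, smul_eq_mul]
  rcases hl : v l with ⟨m, ts⟩ | ⟨m, c⟩
  · rw [treeField_apply_round hv hl q h fun t => ∑ m, ∑ j, M.α q m i j * M.planeTheta t m j]
    have h0 : ∀ w, (treeMatrix v idx q).mulVec w l = 0 := fun w => by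
      simp [Matrix.mulVec, treeMatrix, hl]
    rw [h0, order, planeTheta]
    split_ifs
    · rw [planeThetaProd_apply, pow_add]; ring
    · simp
  · have h0 : ∀ y, treeField v idx q y l = 0 := fun y => by simp [treeField, hl]
    have h1 : ∀ w : Fin d → ℝ, (treeMatrix v idx q).mulVec w l = if m = q then w (idx c) else 0 :=
      fun w => by
        simp only [Matrix.mulVec, treeMatrix, Matrix.of_apply, hl]
        split_ifs <;> simp
    have h2 : v (idx c) = c := hv l c (by simp [hl, children])
    rw [h0, h1, h2, order, planeTheta]
    split_ifs
    · rw [sum_mulVec_apply, pow_add]; ring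
    · simp

end GARKROW

end TreeSystem

-- Extraction of the order conditions

theorem eq_zero_of_pow_mul_isBigO {m n : ℕ} (hmn : m < n) {c : ℝ}
    (h : (fun x : ℝ => x ^ m * c) =O[𝓝[>] 0] fun x : ℝ => x ^ n) : c = 0 := by
  by_contra hc
  have h1 : (fun x : ℝ => x ^ m) =O[𝓝[>] 0] fun x : ℝ => x ^ n :=
    (h.mul (isBigO_refl (fun _ => c⁻¹) _)).trans (isBigO_of_le' (c := ‖c⁻¹‖) _ fun x => by
      rw [norm_mul, mul_comm]) |>.congr_left fun x => by field_simp
  have h2 : (fun x : ℝ => x ^ m) =o[𝓝[>] 0] fun x : ℝ => x ^ m :=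
    h1.trans_isLittleO ((isLittleO_pow_pow hmn).mono nhdsWithin_le_nhds)
  refine isLittleO_irrefl (Eventually.frequently ?_) h2
  filter_upwards [self_mem_nhdsWithin] with x hx
  exact pow_ne_zero m (ne_of_gt hx)

namespace GARKROW

variable (M : GARKROW N)

theorem planeTheta_of_hasOrder {p : ℕ} (H : M.HasOrder p) {t : PlaneTree N} (ht : order t ≤ p) :
    ∑ q, ∑ i, M.b q i * M.planeTheta t q i = exactCoeff t := by
  obtain ⟨d, v, idx, htv, hv⟩ := exists_fin_family t
  have hy0 : (fun j : Fin d => (0 : ℝ) ^ order (v j) * exactCoeff (v j)) = 0 := by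
    funext j
    rw [zero_pow (by have := (v j).order_pos; omega), zero_mul, Pi.zero_apply]
  have hk : Tendsto (fun (h : ℝ) (q : Fin N) (i : Fin (M.s q)) (j : Fin d) =>
      h ^ order (v j) * M.planeTheta (v j) q i) (𝓝[>] 0) (𝓝 0) := by
    refine Tendsto.mono_left ?_ nhdsWithin_le_nhds
    refine tendsto_pi_nhds.2 fun q => tendsto_pi_nhds.2 fun i => tendsto_pi_nhds.2 fun j => ?_
    have hc : Continuous fun h : ℝ => h ^ order (v j) * M.planeTheta (v j) q i := by fun_prop
    have := hc.tendsto 0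
    rwa [zero_pow (by have := (v j).order_pos; omega), zero_mul] at this
  have key := H d (treeField v idx) (contDiff_treeField v idx) (treeMatrix v idx) 0
    (fun s j => s ^ order (v j) * exactCoeff (v j))
    (Eventually.of_forall fun s => hasDerivAt_treeSystem hv s) _ hk
    (Eventually.of_forall fun h => by
      rw [hy0]
      exact M.stageEquations_treeSystem hv h)
  -- In the coordinate of `t` the local error is exactly `h ^ order t` times the defect of the order
  -- condition, and `order t < p + 1` forces that defect to vanish.
  have key' := isBigO_pi.1 key (idx t)
  rw [← sub_eq_zero]
  refine eq_zero_of_pow_mul_isBigO (Nat.lt_succ_of_le ht) (key'.congr_left fun h => ?_)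
  simp only [update, hy0, zero_add, Pi.sub_apply, Finset.sum_apply, Pi.smul_apply, smul_eq_mul, htv,
    mul_sub, Finset.mul_sum]
  congr 1
  exact Finset.sum_congr rfl fun q _ => Finset.sum_congr rfl fun i _ => by ring

theorem hasOrder_iff_planeTheta (p : ℕ) :
    M.HasOrder p ↔ ∀ t : PlaneTree N, order t ≤ p →
      ∑ q, ∑ i, M.b q i * M.planeTheta t q i = exactCoeff t :=
  ⟨fun H _ ht => M.planeTheta_of_hasOrder H ht, M.hasOrder_of_planeTheta⟩

end GARKROW

theorem mainTheorem2 {N : ℕ} (M : GARKROW N) (p : ℕ) :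
    M.HasOrder p ↔
      ∀ t : TW N, 1 ≤ t.order → t.order ≤ p →
        (t.IsT → M.phi t = 1 / (t.density : ℝ)) ∧ (¬ t.IsT → M.phi t = 0) := by
  have hiff : ∀ (t : PlaneTree N) (x : ℝ), x = exactCoeff t ↔
      (AllRound t → x = 1 / (density t : ℝ)) ∧ (¬ AllRound t → x = 0) := fun t x => by
    by_cases h : AllRound t <;> simp [exactCoeff, h]
  rw [M.hasOrder_iff_planeTheta]
  constructor
  -- On the class of a plane representative all lifted functions reduce definitionally to the plane
  -- ones; the empty tree is excluded by `1 ≤ t.order`.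
  · rintro H (_ | ⟨⟨t⟩⟩) h1 hp
    · exact absurd h1 (by simp [TW.order])
    · exact (hiff t _).1 (H t hp)
  · intro H t hp
    exact (hiff t _).2 (H (some (Quot.mk _ t)) t.order_pos hp)
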